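/- Let $\mathcal A$ be a unital $C^*$-algebra and let $H_{\mathcal A}$ be the standard Hilbert $\mathcal A$-module, i.e. the left $\mathcal A$-module of all sequences $x=(x_k)_{k\in\mathbb N}$ in $\mathcal A$ for which $\sum_k x_kx_k^*$ converges in norm, with inner product $\langle x,y\rangle=\sum_k y_kx_k^*$ and norm $\|x\|=\|\langle x,x\rangle\|^{1/2}$. (Taking adjoints entrywise turns this into the right-module picture.) Let $B^a(H_{\mathcal A})$ be the set of bounded adjointable operators on $H_{\mathcal A}$, and let $F^*$ denote the adjoint of $F$. For $F\in B^a(H_{\mathcal A})$, a *diagonal decomposition* $(M_1,N_1,M_2,N_2)$ of $F$ consists of closed submodules of $H_{\mathcal A}$ such that $H_{\mathcal A}=M_1\,\tilde\oplus\,N_1=M_2\,\tilde\oplus\,N_2$ (direct sums, not necessarily orthogonal), $F$ restricts to an isomorphism of $M_1$ onto $M_2$, and $F(N_1)\subseteq N_2$. Here an isomorphism is a bounded $\mathcal A$-linear bijection with bounded inverse. A submodule is finitely generated if it is the $\mathcal A$-linear span of a finite set, and $N\preceq N'$ means that $N$ is isomorphic to a closed submodule of $N'$. Define the following classes of operators $F\in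 B^a(H_{\mathcal A})$: - $\mathcal M\Phi_+$ (respectively $\mathcal M\Phi_-$, $\mathcal M\Phi$): $F$ has a diagonal decomposition with $N_1$ (respectively $N_2$, both $N_1$ and $N_2$) finitely generated. - ${\mathcal M\Phi_+^-}'$: $F\in\mathcal M\Phi_+$ and $F$ has a diagonal decomposition with $N_1$ finitely generated and $N_1\preceq N_2$. - ${\mathcal M\Phi_-^+}'$: $F\in\mathcal M\Phi_-$ and $F$ has a diagonal decomposition with $N_2$ finitely generated and $N_2\preceq N_1$. - $\widetilde{\mathcal M\Phi}{}_+^-$ (respectively $\widetilde{\mathcal M\Phi}{}_-^+$): $F\in\mathcal M\Phi$ and $F$ has a diagonal decomposition with $N_1,N_2$ finitely generated and $N_1\preceq N_2$ (respectively $N_2\preceq N_1$). - $\mathcal M\Phi_+^-=\widetilde{\mathcal M\Phi}{}_+^-\cup(\mathcal M\Phi_+\setminus\mathcal M\Phi)$ and $\mathcal M\Phi_-^+=\widetilde{\mathcal M\Phi}{}_-^+\cup(\mathcal M\Phi_-\setminus\mathcal M\Phi)$. Then for every $F\in B^a(H_{\mathcal A})$: 1. $F\in{\mathcal M\Phi_+^-}'$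 if and only if $F^*\in{\mathcal M\Phi_-^+}'$; 2. $F\in\widetilde{\mathcal M\Phi}{}_+^-$ if and only if $F^*\in\widetilde{\mathcal M\Phi}{}_-^+$; 3. $F\in\mathcal M\Phi_+^-$ if and only if $F^*\in\mathcal M\Phi_-^+$. -/

import Mathlib

open scoped InnerProductSpace

noncomputable section

/-! Hilbert `C⋆`-modules follow Mathlib's `CStarModule` convention: the algebra acts on the left and
the inner product is `A`-linear in its second variable and conjugate linear in its first one. -/

/-! ### The standard Hilbert module over a unital `C⋆`-algebra -/

section Standard

variable {A : Type*} [CStarAlgebra A]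

/-- Comparison test for series of positive elements of a `C⋆`-algebra. -/
theorem summable_of_nonneg_of_le_cstar [PartialOrder A] [StarOrderedRing A] {f g : ℕ → A}
    (hf : ∀ k, 0 ≤ f k) (hfg : ∀ k, f k ≤ g k) (hg : Summable g) : Summable f := by
  rw [summable_iff_vanishing_norm] at hg ⊢
  intro ε hε
  obtain ⟨s, hs⟩ := hg ε hε
  refine ⟨s, fun t ht => lt_of_le_of_lt ?_ (hs t ht)⟩
  exact CStarAlgebra.norm_le_norm_of_nonneg_of_le (Finset.sum_nonneg fun k _ => hf k)
    (Finset.sum_le_sum fun k _ => hfg k)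

theorem summable_add_mul_star {x y : ℕ → A} (hx : Summable fun k => x k * star (x k))
    (hy : Summable fun k => y k * star (y k)) :
    Summable fun k => (x k + y k) * star (x k + y k) := by
  let _ : PartialOrder A := CStarAlgebra.spectralOrder A
  have _ : StarOrderedRing A := CStarAlgebra.spectralOrderedRing A
  refine summable_of_nonneg_of_le_cstar (fun k => mul_star_self_nonneg _) (fun k => ?_)
    ((hx.add hy).add (hx.add hy))
  have h : 0 ≤ (x k - y k) * star (x k - y k) := mul_star_self_nonneg _
  rw [← sub_nonneg]
  convert h using 1
  simp only [star_add, star_sub]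
  noncomm_ring

theorem summable_smul_mul_star (a : A) {x : ℕ → A} (hx : Summable fun k => x k * star (x k)) :
    Summable fun k => (a * x k) * star (a * x k) := by
  have h := (hx.mul_left a).mul_right (star a)
  simpa only [star_mul, mul_assoc] using h

theorem summable_mul_star {x y : ℕ → A} (hx : Summable fun k => x k * star (x k))
    (hy : Summable fun k => y k * star (y k)) : Summable fun k => y k * star (x k) := by
  have key : ∀ c : ℂ, Summable fun k => (y k + c • x k) * star (y k + c • x k) := by
    intro c
    refine summable_add_mul_star hy ?_
    simpa only [smul_mul_assoc, one_mul] using summable_smul_mul_star (c • (1 : A)) hx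
  have h := (((key 1).sub (key (-1))).add (((key Complex.I).sub (key (-Complex.I))).const_smul
    Complex.I)).const_smul ((1 / 4 : ℂ))
  refine h.congr fun k => ?_
  simp only [star_add, star_smul, mul_add, add_mul, smul_mul_assoc, mul_smul_comm, smul_smul,
    smul_add, smul_sub, RCLike.star_def, map_neg, map_one, Complex.conj_I]
  match_scalars <;> simp <;> norm_num

/-- The sequences `(x k)` in `A` for which `∑ x k (x k)⋆` converges in norm. The terms are positive,
so convergence of the partial sums and unconditional convergence are the same. -/
def standardSubmodule (A : Type*) [CStarAlgebra A] : Submodule A (ℕ → A) where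
  carrier := {x | Summable fun k => x k * star (x k)}
  add_mem' hx hy := summable_add_mul_star hx hy
  zero_mem' := by simp [summable_zero]
  smul_mem' a _ hx := summable_smul_mul_star a hx

/-- The standard Hilbert module over `A`. It is a type of its own, so that its topology is the one
of the Hilbert module norm and not that of pointwise convergence. -/
def StandardModule (A : Type*) [CStarAlgebra A] : Type _ := standardSubmodule A

namespace StandardModule

instance : AddCommGroup (StandardModule A) := inferInstanceAs (AddCommGroup (standardSubmodule A))
instance : Module A (StandardModule A) := inferInstanceAs (Module A (standardSubmodule A))
instance : Module ℂ (StandardModule A) := inferInstanceAs (Module ℂ (standardSubmodule A))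
instance : IsScalarTower ℂ A (StandardModule A) :=
  inferInstanceAs (IsScalarTower ℂ A (standardSubmodule A))

instance : CoeFun (StandardModule A) (fun _ => ℕ → A) := ⟨fun x => x.1⟩

@[ext] theorem ext {x y : StandardModule A} (h : ∀ k, x k = y k) : x = y := Subtype.ext (funext h)

@[simp] theorem add_apply (x y : StandardModule A) (k : ℕ) : (x + y) k = x k + y k := rfl
@[simp] theorem zero_apply (k : ℕ) : (0 : StandardModule A) k = 0 := rfl
@[simp] theorem smul_apply (a : A) (x : StandardModule A) (k : ℕ) : (a • x) k = a * x k := rfl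
@[simp] theorem complex_smul_apply (c : ℂ) (x : StandardModule A) (k : ℕ) :
    (c • x) k = c • x k := rfl

theorem summable_inner (x y : StandardModule A) : Summable fun k => y k * star (x k) :=
  summable_mul_star x.2 y.2

/-- The inner product `⟪x, y⟫ = ∑ y k (x k)⋆`. -/
instance : Inner A (StandardModule A) := ⟨fun x y => ∑' k, y k * star (x k)⟩

theorem inner_def (x y : StandardModule A) : ⟪x, y⟫_A = ∑' k, y k * star (x k) := rfl

/-- The norm `‖x‖ = ‖⟪x, x⟫‖ ^ (1 / 2)`. -/
instance : Norm (StandardModule A) := CStarModule.norm A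

variable [PartialOrder A] [StarOrderedRing A]

instance : CStarModule A (StandardModule A) where
  inner_add_right {x y z} := by
    simp only [inner_def, add_apply, add_mul]
    exact (summable_inner x y).tsum_add (summable_inner x z)
  inner_self_nonneg := tsum_nonneg fun k => mul_star_self_nonneg _
  inner_self {x} := by
    constructor
    · intro h
      ext k
      have h1 : x k * star (x k) ≤ ⟪x, x⟫_A :=
        (summable_inner x x).le_tsum k fun j _ => mul_star_self_nonneg _
      rw [h] at h1
      exact (CStarRing.mul_star_self_eq_zero_iff _).1 (le_antisymm h1 (mul_star_self_nonneg _))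
    · rintro rfl
      simp [inner_def]
  inner_op_smul_right {a x y} := by
    simp only [inner_def, smul_apply, mul_assoc]
    exact (summable_inner x y).tsum_mul_left a
  inner_smul_right_complex {c x y} := by
    simp only [inner_def, complex_smul_apply, smul_mul_assoc]
    exact (summable_inner x y).tsum_const_smul c
  star_inner x y := by
    simp only [inner_def]
    rw [tsum_star]
    simp
  norm_eq_sqrt_norm_inner_self _ := rfl

instance : NormedAddCommGroup (StandardModule A) :=
  NormedAddCommGroup.ofCore (CStarModule.normedSpaceCore A)

instance : NormedSpace ℂ (StandardModule A) := .ofCore (CStarModule.normedSpaceCore A)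

end StandardModule

end Standard

/-! ### Adjointable operators -/

section Operators

variable (A E : Type*) [CStarAlgebra A] [PartialOrder A] [StarOrderedRing A]
  [NormedAddCommGroup E] [NormedSpace ℂ E] [Module A E] [CStarModule A E]

/-- A bounded adjointable operator on the Hilbert module `E`: a bounded `A`-linear map together with
its (unique, see `AdjointableOp.ext`) bounded `A`-linear adjoint. -/
structure AdjointableOp where
  toCLM : E →L[A] E
  adjCLM : E →L[A] E
  inner_left : ∀ x y : E, ⟪toCLM x, y⟫_A = ⟪x, adjCLM y⟫_A

namespace AdjointableOp

variable {A E}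

instance : CoeFun (AdjointableOp A E) (fun _ => E → E) := ⟨fun F => F.toCLM⟩

theorem ext {F G : AdjointableOp A E} (h : ∀ x, F x = G x) : F = G := by
  obtain ⟨F, Fs, hF⟩ := F
  obtain ⟨G, Gs, hG⟩ := G
  obtain rfl : F = G := ContinuousLinearMap.ext h
  obtain rfl : Fs = Gs := by
    refine ContinuousLinearMap.ext fun y => ?_
    rw [← sub_eq_zero, ← CStarModule.inner_self (A := A), CStarModule.inner_sub_right, ← hF, ← hG,
      sub_self]
  rfl

/-- The adjoint `F⋆` of an adjointable operator. -/
def adjoint (F : AdjointableOp A E) : AdjointableOp A E where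
  toCLM := F.adjCLM
  adjCLM := F.toCLM
  inner_left x y := by
    rw [← CStarModule.star_inner, ← F.inner_left, CStarModule.star_inner]

end AdjointableOp

/-! ### Classes of semi-Fredholm operators -/

variable {A E}

/-- `E = M₁ ⊕̃ N₁ → M₂ ⊕̃ N₂ = E` are decompositions of `E` into closed submodules (not necessarily
orthogonal) with respect to which the matrix of `F` is diagonal, with an isomorphism `M₁ → M₂` of
Banach modules (bounded, `A`-linear, with bounded inverse) as its first entry. -/
structure IsDiagonalDecomposition (F : AdjointableOp A E) (M₁ N₁ M₂ N₂ : Submodule A E) : Prop where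
  isClosed_M₁ : IsClosed (M₁ : Set E)
  isClosed_N₁ : IsClosed (N₁ : Set E)
  isClosed_M₂ : IsClosed (M₂ : Set E)
  isClosed_N₂ : IsClosed (N₂ : Set E)
  isCompl_domain : IsCompl M₁ N₁
  isCompl_range : IsCompl M₂ N₂
  exists_equiv : ∃ F₁ : M₁ ≃L[A] M₂, ∀ x : M₁, (F₁ x : E) = F x
  map_N : ∀ x ∈ N₁, F x ∈ N₂

/-- `N ⪯ N'`: the submodule `N` is isomorphic to a closed submodule of `N'`. -/
def IsSubequivalent (N N' : Submodule A E) : Prop :=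
  ∃ P : Submodule A E, P ≤ N' ∧ IsClosed (P : Set E) ∧ Nonempty (N ≃L[A] P)

variable (A E)

/-- `MΦ₊`: upper semi-`A`-Fredholm operators. -/
def MPhiPlus : Set (AdjointableOp A E) :=
  {F | ∃ M₁ N₁ M₂ N₂ : Submodule A E, IsDiagonalDecomposition F M₁ N₁ M₂ N₂ ∧ N₁.FG}

/-- `MΦ₋`: lower semi-`A`-Fredholm operators. -/
def MPhiMinus : Set (AdjointableOp A E) :=
  {F | ∃ M₁ N₁ M₂ N₂ : Submodule A E, IsDiagonalDecomposition F M₁ N₁ M₂ N₂ ∧ N₂.FG}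

/-- `MΦ`: `A`-Fredholm operators. -/
def MPhi : Set (AdjointableOp A E) :=
  {F | ∃ M₁ N₁ M₂ N₂ : Submodule A E, IsDiagonalDecomposition F M₁ N₁ M₂ N₂ ∧ N₁.FG ∧ N₂.FG}

/-- The class `MΦ₊⁻′`. -/
def MPhiPlusMinusPrime : Set (AdjointableOp A E) :=
  {F | F ∈ MPhiPlus A E ∧ ∃ M₁ N₁ M₂ N₂ : Submodule A E,
    IsDiagonalDecomposition F M₁ N₁ M₂ N₂ ∧ N₁.FG ∧ IsSubequivalent N₁ N₂}

/-- The class `MΦ₋⁺′`. -/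
def MPhiMinusPlusPrime : Set (AdjointableOp A E) :=
  {F | F ∈ MPhiMinus A E ∧ ∃ M₁ N₁ M₂ N₂ : Submodule A E,
    IsDiagonalDecomposition F M₁ N₁ M₂ N₂ ∧ N₂.FG ∧ IsSubequivalent N₂ N₁}

/-- The tilde class of `MΦ₊⁻`. -/
def MPhiPlusMinusTilde : Set (AdjointableOp A E) :=
  {F | F ∈ MPhi A E ∧ ∃ M₁ N₁ M₂ N₂ : Submodule A E,
    IsDiagonalDecomposition F M₁ N₁ M₂ N₂ ∧ N₁.FG ∧ N₂.FG ∧ IsSubequivalent N₁ N₂}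

/-- The tilde class of `MΦ₋⁺`. -/
def MPhiMinusPlusTilde : Set (AdjointableOp A E) :=
  {F | F ∈ MPhi A E ∧ ∃ M₁ N₁ M₂ N₂ : Submodule A E,
    IsDiagonalDecomposition F M₁ N₁ M₂ N₂ ∧ N₁.FG ∧ N₂.FG ∧ IsSubequivalent N₂ N₁}

/-- The class `MΦ₊⁻`. -/
def MPhiPlusMinus : Set (AdjointableOp A E) :=
  MPhiPlusMinusTilde A E ∪ (MPhiPlus A E \ MPhi A E)

/-- The class `MΦ₋⁺`. -/
def MPhiMinusPlus : Set (AdjointableOp A E) :=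
  MPhiMinusPlusTilde A E ∪ (MPhiMinus A E \ MPhi A E)

end Operators

end

/-!
Diagonal decompositions of `F` are the same thing as outer inverses `G`, that is, `G F G = G`, with
`N₁ = ker (G F)` and `N₂ = ker G`. The adjoint of an adjointable outer inverse of `F` is an outer
inverse of `F⋆`, and its decomposition has, up to isomorphism, the complements of the original one
in the opposite order: an adjointable idempotent and its adjoint have isomorphic kernels, since both
can be compared with an orthogonal projection.

So it remains to make `G` adjointable when `N₁` or `N₂` is finitely generated. An adjointable `T`
with closed range has an adjointable inner inverse, because `T T⋆` is invertible on the range of `T`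
by the method of continuity (`T T⋆ + t` is bounded below there, uniformly in `t ≥ 0`). Applied to
the map `Aⁿ → E` given by generators, this makes a closed finitely generated submodule the kernel of
an adjointable idempotent `r`. Applied to `F r` or `r F`, it then gives the adjointable `G`.
-/

section Banach

theorem isUnit_of_norm_sub_lt_of_le_norm_apply {𝕜 X : Type*} [NontriviallyNormedField 𝕜]
    [NormedAddCommGroup X] [NormedSpace 𝕜 X] [CompleteSpace X] {U S : X →L[𝕜] X} {c : ℝ}
    (hU : IsUnit U) (hlow : ∀ x, c * ‖x‖ ≤ ‖U x‖) (hSU : ‖S - U‖ < c) : IsUnit S := by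
  cases subsingleton_or_nontrivial X
  · exact isUnit_of_subsingleton S
  obtain ⟨u, rfl⟩ := hU
  have hc : 0 < c := (norm_nonneg _).trans_lt hSU
  have hinv : ‖(↑u⁻¹ : X →L[𝕜] X)‖ ≤ c⁻¹ :=
    ContinuousLinearMap.opNorm_le_bound _ (inv_nonneg.2 hc.le) fun x => by
      have hx : (u : X →L[𝕜] X) ((↑u⁻¹ : X →L[𝕜] X) x) = x :=
        DFunLike.congr_fun u.mul_inv x
      rw [le_inv_mul_iff₀ hc]
      simpa only [hx] using hlow ((↑u⁻¹ : X →L[𝕜] X) x)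
  exact (u.ofNearby S (hSU.trans_le (le_inv_of_le_inv₀ (norm_pos_iff.2 u⁻¹.ne_zero) hinv))).isUnit

variable {X : Type*} [NormedAddCommGroup X] [NormedSpace ℝ X] [CompleteSpace X]

theorem isUnit_of_forall_le_norm_add_smul (S : X →L[ℝ] X) {c : ℝ} (hc : 0 < c)
    (hlow : ∀ t : ℝ, 0 ≤ t → ∀ x, c * ‖x‖ ≤ ‖S x + t • x‖) : IsUnit S := by
  have descend : ∀ n : ℕ, IsUnit (S + (n * (c / 2)) • 1) → IsUnit S := fun n => by
    induction n with
    | zero => simp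
    | succ n ih =>
      refine fun h => ih (isUnit_of_norm_sub_lt_of_le_norm_apply h
        (fun x => by simpa using hlow ((n + 1 : ℕ) * (c / 2)) (by positivity) x) ?_)
      have hstep : S + (n * (c / 2)) • 1 - (S + ((n + 1 : ℕ) * (c / 2)) • 1) =
          (-(c / 2)) • (1 : X →L[ℝ] X) := by
        push_cast
        module
      calc ‖S + (n * (c / 2)) • 1 - (S + ((n + 1 : ℕ) * (c / 2)) • 1)‖
          ≤ c / 2 * ‖(1 : X →L[ℝ] X)‖ := by
            rw [hstep, norm_smul, norm_neg, Real.norm_of_nonneg (by positivity)]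
        _ ≤ c / 2 := mul_le_of_le_one_right (by positivity) ContinuousLinearMap.norm_id_le
        _ < c := half_lt_self hc
  obtain ⟨n, hn⟩ := exists_nat_gt (‖S‖ / (c / 2))
  rw [div_lt_iff₀ (half_pos hc)] at hn
  have hpos : 0 < n * (c / 2) := (norm_nonneg S).trans_lt hn
  have hunit : IsUnit ((n * (c / 2)) • (1 : X →L[ℝ] X)) := by
    simpa only [Algebra.algebraMap_eq_smul_one] using
      (IsUnit.mk0 _ hpos.ne').map (algebraMap ℝ (X →L[ℝ] X))
  refine descend n (isUnit_of_norm_sub_lt_of_le_norm_apply hunit (fun x => ?_)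
    (by simpa only [add_sub_cancel_right] using hn))
  simp [norm_smul, abs_of_pos hc]

variable (𝕜 : Type*) {R E F : Type*} [NontriviallyNormedField 𝕜] [Ring R]
  [NormedAddCommGroup E] [NormedSpace 𝕜 E] [Module R E] [CompleteSpace E]

theorem exists_continuousLinearEquiv_of_bijective [NormedAddCommGroup F] [NormedSpace 𝕜 F]
    [Module R F] [CompleteSpace F] [LinearMap.CompatibleSMul E F 𝕜 R] (T : E →L[R] F)
    (hT : Function.Bijective T) : ∃ e : E ≃L[R] F, ∀ x, e x = T x :=
  ⟨⟨.ofBijective (T : E →ₗ[R] F) hT, T.continuous,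
    (LinearEquiv.ofBijective (T : E →ₗ[R] F) hT).toEquiv.continuous_symm_iff.2
      ((T.restrictScalars 𝕜).isOpenMap hT.2)⟩, fun _ => rfl⟩

theorem isTopCompl_of_isCompl_of_isClosed [Module 𝕜 R] [IsScalarTower 𝕜 R E]
    {M N : Submodule R E} (h : IsCompl M N) (hM : IsClosed (M : Set E))
    (hN : IsClosed (N : Set E)) : Submodule.IsTopCompl M N := by
  have h𝕜 : IsCompl (M.restrictScalars 𝕜) (N.restrictScalars 𝕜) :=
    (Submodule.isCompl_restrictScalars_iff 𝕜).2 h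
  exact ⟨h, (Submodule.IsCompl.isTopCompl_of_isClosed h𝕜 hM hN).continuous_projection⟩

end Banach

section ScalarTower

variable {A E : Type*} [CStarAlgebra A] [PartialOrder A] [NormedAddCommGroup E]
  [NormedSpace ℂ E] [Module A E] [CStarModule A E]

variable (A) in
theorem eq_of_forall_inner_eq {x y : E} (h : ∀ z : E, ⟪z, x⟫_A = ⟪z, y⟫_A) : x = y := by
  rw [← sub_eq_zero, ← CStarModule.inner_self (A := A), CStarModule.inner_sub_right, h, sub_self]

instance isScalarTower_of_cstarModule : IsScalarTower ℂ A E where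
  smul_assoc c a x := eq_of_forall_inner_eq A fun z => by simp

theorem norm_smul_le_of_cstarModule (a : A) (x : E) : ‖a • x‖ ≤ ‖a‖ * ‖x‖ := by
  refine (pow_le_pow_iff_left₀ (norm_nonneg _) (by positivity) two_ne_zero).1 ?_
  calc ‖a • x‖ ^ 2 = ‖a * ⟪x, x⟫_A * star a‖ := by
        simp [CStarModule.norm_sq_eq A, mul_assoc]
    _ ≤ ‖a‖ * ‖⟪x, x⟫_A‖ * ‖a‖ := by
        simpa only [norm_star] using norm_mul₃_le (a := a) (b := ⟪x, x⟫_A) (c := star a)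
    _ = (‖a‖ * ‖x‖) ^ 2 := by rw [← CStarModule.norm_sq_eq A]; ring

instance isBoundedSMul_of_cstarModule : IsBoundedSMul A E :=
  .of_norm_smul_le norm_smul_le_of_cstarModule

end ScalarTower

section Adjoint

variable {A X Y Z : Type*} [CStarAlgebra A] [PartialOrder A]
  [NormedAddCommGroup X] [NormedSpace ℂ X] [Module A X] [CStarModule A X]
  [NormedAddCommGroup Y] [NormedSpace ℂ Y] [Module A Y] [CStarModule A Y]
  [NormedAddCommGroup Z] [NormedSpace ℂ Z] [Module A Z] [CStarModule A Z]

/-- The operators `T` and `T'` between Hilbert modules are adjoint to each other. Unlike for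
`AdjointableOp`, the two modules may differ. -/
def AreAdjoint (T : X →L[A] Y) (T' : Y →L[A] X) : Prop := ∀ x y, ⟪T x, y⟫_A = ⟪x, T' y⟫_A

namespace AreAdjoint

variable {T S : X →L[A] Y} {T' S' : Y →L[A] X}

theorem symm (h : AreAdjoint T T') : AreAdjoint T' T := fun x y => by
  rw [← CStarModule.star_inner, ← h, CStarModule.star_inner]

theorem comp {U : Y →L[A] Z} {U' : Z →L[A] Y} (hU : AreAdjoint U U') (hT : AreAdjoint T T') :
    AreAdjoint (U ∘L T) (T' ∘L U') := fun x z => (hU _ z).trans (hT x _)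

theorem mul {P Q P' Q' : X →L[A] X} (hP : AreAdjoint P P') (hQ : AreAdjoint Q Q') :
    AreAdjoint (P * Q) (Q' * P') := hP.comp hQ

theorem one_sub {P P' : X →L[A] X} (h : AreAdjoint P P') : AreAdjoint (1 - P) (1 - P') :=
  fun x y => by simp [h x y]

theorem eq (h : AreAdjoint T T') (h' : AreAdjoint T S') : T' = S' :=
  ContinuousLinearMap.ext fun y => eq_of_forall_inner_eq A fun x => by rw [← h, ← h']

theorem inner_symm_equiv_range (h : AreAdjoint T T') {K : T.range ≃L[A] T.range}
    (hK : ∀ y, (K y : Y) = T (T' y)) (y z : T.range) :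
    ⟪(K.symm y : Y), (z : Y)⟫_A = ⟪(y : Y), (K.symm z : Y)⟫_A := by
  have hsymm := (h.comp h.symm) (K.symm y) (K.symm z)
  simpa only [ContinuousLinearMap.comp_apply, ← hK, K.apply_symm_apply] using hsymm.symm

end AreAdjoint

end Adjoint

section ClosedRange

variable {A X Y : Type*} [CStarAlgebra A] [PartialOrder A] [StarOrderedRing A]
  [NormedAddCommGroup X] [NormedSpace ℂ X] [Module A X] [CStarModule A X]
  [NormedAddCommGroup Y] [NormedSpace ℂ Y] [Module A Y] [CStarModule A Y]
  {T : X →L[A] Y} {T' : Y →L[A] X}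

namespace AreAdjoint

theorem norm_sq_adjoint_le (h : AreAdjoint T T') {t : ℝ} (ht : 0 ≤ t) (y : Y) :
    ‖T' y‖ ^ 2 ≤ ‖T (T' y) + t • y‖ * ‖y‖ := by
  rw [CStarModule.norm_sq_eq A]
  refine (CStarAlgebra.norm_le_norm_of_nonneg_of_le CStarModule.inner_self_nonneg ?_).trans
    (CStarModule.norm_inner_le Y (A := A))
  rw [CStarModule.inner_add_left, h, CStarModule.inner_smul_left_real]
  exact le_add_of_nonneg_right (smul_nonneg ht CStarModule.inner_self_nonneg)

variable [CompleteSpace X] [CompleteSpace Y]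

theorem exists_norm_le_mul_norm_adjoint (h : AreAdjoint T T') (hT : IsClosed (T.range : Set Y)) :
    ∃ C > 0, ∀ y ∈ T.range, ‖y‖ ≤ C * ‖T' y‖ := by
  have : CompleteSpace T.range := hT.completeSpace_coe
  let T₀ : X →L[ℂ] T.range := T.rangeRestrict.restrictScalars ℂ
  obtain ⟨C, hC, hpre⟩ := T₀.exists_preimage_norm_le Set.rangeFactorization_surjective
  refine ⟨C, hC, fun y hy => ?_⟩
  obtain ⟨x, hx, hxy⟩ := hpre ⟨y, hy⟩
  have hTx : T x = y := congrArg Subtype.val hx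
  have hsq : ‖y‖ * ‖y‖ ≤ C * ‖T' y‖ * ‖y‖ :=
    calc ‖y‖ * ‖y‖ = ‖⟪x, T' y⟫_A‖ := by rw [← sq, CStarModule.norm_sq_eq A, ← h, hTx]
      _ ≤ ‖x‖ * ‖T' y‖ := CStarModule.norm_inner_le X
      _ ≤ C * ‖y‖ * ‖T' y‖ := by gcongr; exact hxy
      _ = C * ‖T' y‖ * ‖y‖ := by ring
  rcases (norm_nonneg y).eq_or_lt' with hy₀ | hy₀
  · rw [hy₀]; positivity
  · exact le_of_mul_le_mul_right hsq hy₀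

theorem exists_equiv_range (h : AreAdjoint T T') (hT : IsClosed (T.range : Set Y)) :
    ∃ K : T.range ≃L[A] T.range, ∀ y, (K y : Y) = T (T' y) := by
  have : CompleteSpace T.range := hT.completeSpace_coe
  obtain ⟨C, hC, hlow⟩ := h.exists_norm_le_mul_norm_adjoint hT
  let K : T.range →L[A] T.range := T.rangeRestrict ∘L T' ∘L T.range.subtypeL
  have hbound : ∀ t : ℝ, 0 ≤ t → ∀ y : T.range, (C ^ 2)⁻¹ * ‖y‖ ≤ ‖K y + t • y‖ := by
    intro t ht y
    have hsq : ‖y‖ * ‖y‖ ≤ C ^ 2 * ‖K y + t • y‖ * ‖y‖ :=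
      calc ‖y‖ * ‖y‖ ≤ (C * ‖T' y‖) * (C * ‖T' y‖) := by gcongr <;> exact hlow y y.2
        _ = C ^ 2 * ‖T' y‖ ^ 2 := by ring
        _ ≤ C ^ 2 * (‖K y + t • y‖ * ‖y‖) := by gcongr; exact h.norm_sq_adjoint_le ht y
        _ = C ^ 2 * ‖K y + t • y‖ * ‖y‖ := by ring
    rw [inv_mul_le_iff₀ (by positivity)]
    rcases (norm_nonneg y).eq_or_lt' with hy₀ | hy₀
    · rw [hy₀]; positivity
    · exact le_of_mul_le_mul_right hsq hy₀
  have hK : IsUnit (K.restrictScalars ℝ) :=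
    isUnit_of_forall_le_norm_add_smul _ (by positivity) hbound
  obtain ⟨e, he⟩ := exists_continuousLinearEquiv_of_bijective ℝ K
    (ContinuousLinearMap.isUnit_iff_bijective.1 hK)
  exact ⟨e, fun y => congrArg Subtype.val (he y)⟩

theorem exists_orthogonal_projection_range (h : AreAdjoint T T')
    (hT : IsClosed (T.range : Set Y)) :
    ∃ P : Y →L[A] T.range, (∀ z : T.range, P z = z) ∧
      ∀ y (z : T.range), ⟪(P y : Y), (z : Y)⟫_A = ⟪y, (z : Y)⟫_A := by
  obtain ⟨K, hK⟩ := h.exists_equiv_range hT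
  refine ⟨(K.symm : T.range →L[A] T.range) ∘L T.rangeRestrict ∘L T', fun z => ?_, fun y z => ?_⟩
  · exact K.symm_apply_eq.2 (Subtype.ext (hK z).symm)
  calc ⟪(K.symm (T.rangeRestrict (T' y)) : Y), (z : Y)⟫_A
      = ⟪T (T' y), (K.symm z : Y)⟫_A := h.inner_symm_equiv_range hK _ _
    _ = ⟪y, T (T' (K.symm z))⟫_A := (h.comp h.symm) y _
    _ = ⟪y, (z : Y)⟫_A := by rw [← hK, K.apply_symm_apply]

/-- With `P` the orthogonal projection onto the range of `T`, take `S = T⋆ (T T⋆)⁻¹ P`. -/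
theorem exists_inner_inverse (h : AreAdjoint T T') (hT : IsClosed (T.range : Set Y)) :
    ∃ (S : Y →L[A] X) (S' : X →L[A] Y), AreAdjoint S S' ∧ T ∘L S ∘L T = T ∧
      AreAdjoint (T ∘L S) (T ∘L S) := by
  obtain ⟨K, hK⟩ := h.exists_equiv_range hT
  obtain ⟨P, hPT, hP⟩ := h.exists_orthogonal_projection_range hT
  have hP_right : ∀ (z : T.range) y, ⟪(z : Y), (P y : Y)⟫_A = ⟪(z : Y), y⟫_A := fun z y => by
    rw [← CStarModule.star_inner, hP, CStarModule.star_inner]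
  let Q : Y →L[A] Y := T.range.subtypeL ∘L (K.symm : T.range →L[A] T.range) ∘L P
  have hQ : AreAdjoint Q Q := fun x y => by
    change ⟪(K.symm (P x) : Y), y⟫_A = ⟪x, (K.symm (P y) : Y)⟫_A
    rw [← hP_right, h.inner_symm_equiv_range hK, hP]
  have hTQ : ∀ y, T (T' (Q y)) = P y := fun y => by
    change T (T' (K.symm (P y))) = _
    rw [← hK, K.apply_symm_apply]
  refine ⟨T' ∘L Q, Q ∘L T, h.symm.comp hQ, ?_, fun x y => ?_⟩
  · ext x
    exact (hTQ (T x)).trans (congrArg Subtype.val (hPT (T.rangeRestrict x)))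
  · change ⟪T (T' (Q x)), y⟫_A = ⟪x, T (T' (Q y))⟫_A
    rw [hTQ, hTQ, ← hP_right, hP]

end AreAdjoint

end ClosedRange

section InnerInverse

variable {R X Y : Type*} [Ring R] [NormedAddCommGroup X] [Module R X] [NormedAddCommGroup Y]
  [Module R Y] {T : X →L[R] Y} {S : Y →L[R] X}

theorem isIdempotentElem_comp_of_comp_comp_eq (h : T ∘L S ∘L T = T) :
    IsIdempotentElem (T ∘L S) := by
  change (T ∘L S ∘L T) ∘L S = T ∘L S
  rw [h]

theorem range_comp_of_comp_comp_eq (h : T ∘L S ∘L T = T) : (T ∘L S).range = T.range :=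
  le_antisymm (LinearMap.range_comp_le_range (S : Y →ₗ[R] X) (T : X →ₗ[R] Y)) <| by
    rintro _ ⟨x, rfl⟩
    exact ⟨T x, DFunLike.congr_fun h x⟩

theorem isClosed_range_of_comp_comp_eq (h : T ∘L S ∘L T = T) : IsClosed (T.range : Set Y) :=
  range_comp_of_comp_comp_eq h ▸ (ContinuousLinearMap.IsIdempotentElem.isTopCompl
    (isIdempotentElem_comp_of_comp_comp_eq h)).isClosed

end InnerInverse

section FinitelyGenerated

variable {A E ι : Type*} [CStarAlgebra A] [PartialOrder A] [StarOrderedRing A]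
  [NormedAddCommGroup E] [NormedSpace ℂ E] [Module A E] [CStarModule A E] [Fintype ι]

/-- The synthesis operator `x ↦ ∑ i, x i • g i` of a finite family `g`. -/
noncomputable def synthesisOperator (g : ι → E) : WithCStarModule A (ι → A) →L[A] E :=
  ⟨Fintype.linearCombination A g, continuous_finsetSum _ fun i _ =>
    Continuous.smul (f := fun x : WithCStarModule A (ι → A) => x i)
      ((continuous_apply i).comp (WithCStarModule.equivL A).continuous) continuous_const⟩

/-- The analysis operator `y ↦ (⟪g i, y⟫)ᵢ` of a finite family `g`. -/
noncomputable def analysisOperator (g : ι → E) : E →L[A] WithCStarModule A (ι → A) where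
  toFun y := (WithCStarModule.equiv A (ι → A)).symm fun i => ⟪g i, y⟫_A
  map_add' x y := by ext i; simp
  map_smul' a y := by ext i; simp
  cont := (WithCStarModule.equivL (A := A) A).symm.continuous.comp <|
    continuous_pi fun i => (CStarModule.innerSL (g i)).continuous

theorem areAdjoint_synthesisOperator_analysisOperator (g : ι → E) :
    AreAdjoint (A := A) (synthesisOperator g) (analysisOperator g) := fun x y =>
  calc ⟪∑ i, x i • g i, y⟫_A = ∑ i, ⟪g i, y⟫_A * star (x i) := by simp
    _ = ⟪x, analysisOperator g y⟫_A := rfl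

theorem exists_isIdempotentElem_range_eq [CompleteSpace E] {N : Submodule A E} (hN : N.FG)
    (hc : IsClosed (N : Set E)) :
    ∃ p p' : E →L[A] E, AreAdjoint p p' ∧ IsIdempotentElem p ∧ p.range = N := by
  obtain ⟨n, g, rfl⟩ := Submodule.fg_iff_exists_fin_generating_family.1 hN
  have hT := areAdjoint_synthesisOperator_analysisOperator (A := A) g
  have hrange : (synthesisOperator (A := A) g).range = Submodule.span A (Set.range g) :=
    Fintype.range_linearCombination A g
  obtain ⟨S, S', hS, hTST, -⟩ := hT.exists_inner_inverse (hrange ▸ hc)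
  exact ⟨_, _, hT.comp hS, isIdempotentElem_comp_of_comp_comp_eq hTST,
    (range_comp_of_comp_comp_eq hTST).trans hrange⟩

theorem exists_isIdempotentElem_ker_eq [CompleteSpace E] {N : Submodule A E} (hN : N.FG)
    (hc : IsClosed (N : Set E)) :
    ∃ r r' : E →L[A] E, AreAdjoint r r' ∧ IsIdempotentElem r ∧ r.ker = N := by
  obtain ⟨p, p', hp, hpp, rfl⟩ := exists_isIdempotentElem_range_eq hN hc
  exact ⟨1 - p, 1 - p', hp.one_sub, hpp.one_sub,
    (LinearMap.IsIdempotentElem.range_eq_ker_one_sub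
      (ContinuousLinearMap.IsIdempotentElem.toLinearMap hpp)).symm⟩

end FinitelyGenerated

section SubmoduleEquiv

variable {R E : Type*} [Ring R] [AddCommGroup E] [TopologicalSpace E] [Module R E]

/-- The equivalence of submodules whose two directions are restrictions of operators on the whole
modules. -/
def submoduleEquivOfMapsTo {F : Type*} [AddCommGroup F] [TopologicalSpace F] [Module R F]
    {N : Submodule R E} {P : Submodule R F} (u : E →L[R] F) (v : F →L[R] E)
    (hu : Set.MapsTo u N P) (hv : Set.MapsTo v P N) (hvu : Set.LeftInvOn v u N)
    (huv : Set.LeftInvOn u v P) : N ≃L[R] P :=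
  .equivOfInverse (u.restrict hu) (v.restrict hv)
    (fun x => Subtype.ext (hvu x.2)) (fun x => Subtype.ext (huv x.2))

/-- The hypotheses say that `e` and `f` are idempotents with the same range. -/
theorem nonempty_ker_equiv_ker_of_mul_eq [IsTopologicalAddGroup E] {e f : E →L[R] E}
    (hef : e * f = f) (hfe : f * e = e) : Nonempty (e.ker ≃L[R] f.ker) := by
  have hmaps : ∀ {a b : E →L[R] E}, a * b = b → b * a = a →
      Set.MapsTo (1 - b : E →L[R] E) a.ker b.ker := fun {a b} hab hba x _ => by
    have hb : b * (1 - b) = 0 := by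
      nth_rw 2 [← hab]
      rw [mul_sub, mul_one, ← mul_assoc, hba, hab, sub_self]
    exact DFunLike.congr_fun hb x
  have hinv : ∀ {a b : E →L[R] E}, a * b = b →
      Set.LeftInvOn (1 - a : E →L[R] E) (1 - b : E →L[R] E) a.ker := fun {a b} hab x hx => by
    have hmul : (1 - a) * (1 - b) = 1 - a := by noncomm_ring [hab]
    calc (1 - a) ((1 - b) x) = x - a x := DFunLike.congr_fun hmul x
      _ = x := by rw [show a x = 0 from hx, sub_zero]
  exact ⟨submoduleEquivOfMapsTo (1 - f) (1 - e) (hmaps hef hfe) (hmaps hfe hef) (hinv hef)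
    (hinv hfe)⟩

end SubmoduleEquiv

section OuterInverse

/-- `g` is an outer inverse of `f`, equivalently `f` is an inner inverse of `g`. -/
def IsOuterInverse {S : Type*} [Mul S] (g f : S) : Prop := g * f * g = g

namespace IsOuterInverse

section Semigroup

variable {S : Type*} [Semigroup S] {g f : S}

theorem isIdempotentElem_mul_right (h : IsOuterInverse g f) : IsIdempotentElem (g * f) := by
  rw [IsIdempotentElem, ← mul_assoc, h]

theorem isIdempotentElem_mul_left (h : IsOuterInverse g f) : IsIdempotentElem (f * g) := by
  rw [IsIdempotentElem, mul_assoc, ← mul_assoc g, h]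

end Semigroup

variable {R E : Type*} [Ring R] [AddCommGroup E] [TopologicalSpace E] [Module R E]
  {G F : E →L[R] E}

theorem apply (h : IsOuterInverse G F) (x : E) : G (F (G x)) = G x := DFunLike.congr_fun h x

theorem ker_mul_left (h : IsOuterInverse G F) : (F * G).ker = G.ker :=
  le_antisymm (fun x (hx : F (G x) = 0) => show G x = 0 by rw [← h.apply, hx, map_zero])
    (LinearMap.ker_le_ker_comp _ _)

theorem nonempty_ker_mul_equiv_ker_mul [IsTopologicalAddGroup E] {T S : E →L[R] E}
    (hTG : IsOuterInverse T G) (hTS : IsOuterInverse T S) :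
    Nonempty ((T * G).ker ≃L[R] (T * S).ker) :=
  nonempty_ker_equiv_ker_of_mul_eq (by rw [← mul_assoc, hTG]) (by rw [← mul_assoc, hTS])

end IsOuterInverse

variable {A E : Type*} [CStarAlgebra A] [PartialOrder A]
  [NormedAddCommGroup E] [NormedSpace ℂ E] [Module A E] [CStarModule A E]
  {F : AdjointableOp A E}

theorem IsOuterInverse.isDiagonalDecomposition {G : E →L[A] E} (h : IsOuterInverse G F.toCLM) :
    IsDiagonalDecomposition F (G * F.toCLM).range (G * F.toCLM).ker (F.toCLM * G).range G.ker := by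
  have hGF := ContinuousLinearMap.IsIdempotentElem.isTopCompl h.isIdempotentElem_mul_right
  have hFG := ContinuousLinearMap.IsIdempotentElem.isTopCompl h.isIdempotentElem_mul_left
  rw [h.ker_mul_left] at hFG
  refine ⟨hGF.isClosed, hGF.isClosed', hFG.isClosed, hFG.isClosed', hGF.isCompl, hFG.isCompl,
    ⟨submoduleEquivOfMapsTo F.toCLM G ?_ ?_ ?_ ?_, fun _ => rfl⟩, fun _ hx => hx⟩
  · rintro _ ⟨x, rfl⟩
    exact ⟨F x, rfl⟩
  · rintro _ ⟨x, rfl⟩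
    exact ⟨G x, rfl⟩
  · rintro _ ⟨x, rfl⟩
    exact h.apply (F x)
  · rintro _ ⟨x, rfl⟩
    exact congrArg F (h.apply x)

theorem IsDiagonalDecomposition.exists_isOuterInverse [CompleteSpace E]
    {M₁ N₁ M₂ N₂ : Submodule A E} (h : IsDiagonalDecomposition F M₁ N₁ M₂ N₂) :
    ∃ G : E →L[A] E, IsOuterInverse G F.toCLM ∧ (G * F.toCLM).ker = N₁ ∧ G.ker = N₂ := by
  obtain ⟨F₁, hF₁⟩ := h.exists_equiv
  have hcompl := isTopCompl_of_isCompl_of_isClosed ℂ h.isCompl_range h.isClosed_M₂ h.isClosed_N₂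
  let p := M₂.projectionOntoL N₂ hcompl
  let G : E →L[A] E := M₁.subtypeL ∘L (F₁.symm : M₂ →L[A] M₁) ∘L p
  have hGF : ∀ m : M₁, G (F m) = m := fun m => by
    change (F₁.symm (p (F m)) : E) = m
    rw [← hF₁, Submodule.projectionOntoL_apply_left, F₁.symm_apply_apply]
  have hG : ∀ y, G y = 0 ↔ y ∈ N₂ := fun y => by
    change (F₁.symm (p y) : E) = 0 ↔ _
    rw [ZeroMemClass.coe_eq_zero, EmbeddingLike.map_eq_zero_iff,
      Submodule.projectionOntoL_apply_eq_zero_iff]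
  refine ⟨G, ContinuousLinearMap.ext fun y => hGF (F₁.symm (p y)), ?_, Submodule.ext hG⟩
  refine le_antisymm (fun x (hx : G (F x) = 0) => ?_) fun x hx => (hG _).2 (h.map_N x hx)
  obtain ⟨m, n, rfl, -⟩ := Submodule.existsUnique_add_of_isCompl h.isCompl_domain x
  have hm : (m : E) = 0 := by
    rwa [map_add, map_add, hGF, (hG _).2 (h.map_N n n.2), add_zero] at hx
  rw [hm, zero_add]
  exact n.2

end OuterInverse

theorem mul_eq_of_ker_le {R E : Type*} [Ring R] [AddCommGroup E] [TopologicalSpace E] [Module R E]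
    {r T : E →L[R] E} (hr : IsIdempotentElem r) (h : r.ker ≤ T.ker) : T * r = T :=
  ContinuousLinearMap.coe_injective <|
    (LinearMap.IsIdempotentElem.comp_eq_left_iff
      (ContinuousLinearMap.IsIdempotentElem.toLinearMap hr) (T : E →ₗ[R] E)).2 h

theorem IsOuterInverse.adjoint {A E : Type*} [CStarAlgebra A] [PartialOrder A]
    [NormedAddCommGroup E] [NormedSpace ℂ E] [Module A E] [CStarModule A E]
    {f f' G G' : E →L[A] E} (h : IsOuterInverse G f) (hf : AreAdjoint f f')
    (hG : AreAdjoint G G') : IsOuterInverse G' f' :=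
  (mul_assoc _ _ _).trans (((hG.mul hf).mul hG).eq (h.symm ▸ hG))

section AdjointableOuterInverse

variable {A E : Type*} [CStarAlgebra A] [PartialOrder A] [StarOrderedRing A]
  [NormedAddCommGroup E] [NormedSpace ℂ E] [Module A E] [CStarModule A E] [CompleteSpace E]

/-- `f` is the orthogonal projection with the same kernel as `e`. -/
theorem AreAdjoint.exists_areAdjoint_self_mul_eq {e e' : E →L[A] E} (h : AreAdjoint e e')
    (he : IsIdempotentElem e) :
    ∃ f : E →L[A] E, AreAdjoint f f ∧ e * f = e ∧ f * e = f := by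
  have hclosed := isClosed_range_of_comp_comp_eq (T := 1 - e) (S := 1) he.one_sub
  obtain ⟨S, -, -, hS, hsa⟩ := h.one_sub.exists_inner_inverse hclosed
  change (1 - e) * (S * (1 - e)) = 1 - e at hS
  refine ⟨1 - (1 - e) * S, hsa.one_sub, ?_, ?_⟩
  · rw [mul_sub, ← mul_assoc, he.mul_one_sub_self, zero_mul, sub_zero, mul_one]
  · calc (1 - (1 - e) * S) * e = e - (1 - e) * S + (1 - e) * (S * (1 - e)) := by noncomm_ring
      _ = 1 - (1 - e) * S := by rw [hS]; abel

theorem AreAdjoint.nonempty_ker_equiv_ker {e e' : E →L[A] E} (h : AreAdjoint e e')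
    (he : IsIdempotentElem e) : Nonempty (e.ker ≃L[A] e'.ker) := by
  obtain ⟨f, hf, hef, hfe⟩ := h.exists_areAdjoint_self_mul_eq he
  have hker : e.ker = f.ker := le_antisymm
    (hfe ▸ LinearMap.ker_le_ker_comp e.toLinearMap f.toLinearMap)
    (hef ▸ LinearMap.ker_le_ker_comp f.toLinearMap e.toLinearMap)
  have he'f : e' * f = f := (hf.mul h).eq (hfe.symm ▸ hf)
  have hfe' : f * e' = e' := (h.mul hf).eq (hef.symm ▸ h)
  rw [hker]
  exact nonempty_ker_equiv_ker_of_mul_eq hfe' he'f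

theorem AreAdjoint.exists_isOuterInverse {T T' G : E →L[A] E} (h : AreAdjoint T T')
    (hTG : IsOuterInverse T G) :
    ∃ S S' : E →L[A] E, AreAdjoint S S' ∧ IsOuterInverse T S := by
  obtain ⟨S, S', hS, hTS, -⟩ := h.exists_inner_inverse (isClosed_range_of_comp_comp_eq hTG)
  exact ⟨S, S', hS, hTS⟩

/-- With `r` an adjointable projection along `ker (G f)`, `G` is an inner inverse of the adjointable
operator `f r`. Compose an adjointable inner inverse of `f r` with `r`. -/
theorem IsOuterInverse.exists_areAdjoint_of_fg_ker_mul {f f' G : E →L[A] E}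
    (hGf : IsOuterInverse G f) (hf : AreAdjoint f f') (hN : (G * f).ker.FG) :
    ∃ H H' : E →L[A] E, AreAdjoint H H' ∧ IsOuterInverse H f ∧
      Nonempty ((G * f).ker ≃L[A] (H * f).ker) ∧ Nonempty (G.ker ≃L[A] H.ker) := by
  obtain ⟨r, r', hr, hrr, hker⟩ := exists_isIdempotentElem_ker_eq hN (G * f).isClosed_ker
  have hrGf : r * (G * f) = r := mul_eq_of_ker_le hGf.isIdempotentElem_mul_right hker.ge
  have hGfr : G * (f * r) = G * f := by rw [← mul_assoc, mul_eq_of_ker_le hrr hker.le]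
  have hGT : IsOuterInverse G (f * r) := by rw [IsOuterInverse, hGfr, hGf]
  have hTG : IsOuterInverse (f * r) G := by rw [IsOuterInverse, mul_assoc, hGfr, mul_assoc, hrGf]
  obtain ⟨S, S', hS, hTS⟩ := (hf.mul hr).exists_isOuterInverse hTG
  have hrST : r * S * (f * r) = r := calc
    r * S * (f * r) = r * (G * f) * S * (f * r) := by rw [hrGf]
    _ = r * (G * (f * r)) * S * (f * r) := by rw [hGfr]
    _ = r * G * (f * r * S * (f * r)) := by simp only [mul_assoc]
    _ = r := by rw [hTS, mul_assoc, hGfr, hrGf]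
  have hH : IsOuterInverse (r * S) f := by
    rw [IsOuterInverse, mul_assoc, ← mul_assoc f, ← mul_assoc, hrST]
  refine ⟨r * S, S' * r', hr.mul hS, hH, ?_, ?_⟩
  · rw [← hker]
    exact nonempty_ker_equiv_ker_of_mul_eq (by rw [← mul_assoc, ← mul_assoc, hrr.eq])
      (by rw [mul_assoc, hrST])
  · rw [← hGT.ker_mul_left, ← hH.ker_mul_left, ← mul_assoc]
    exact hTG.nonempty_ker_mul_equiv_ker_mul hTS

/-- As before, with `r` an adjointable projection along `ker G` and the operator `r f`. -/
theorem IsOuterInverse.exists_areAdjoint_of_fg_ker {f f' G : E →L[A] E}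
    (hGf : IsOuterInverse G f) (hf : AreAdjoint f f') (hN : G.ker.FG) :
    ∃ H H' : E →L[A] E, AreAdjoint H H' ∧ IsOuterInverse H f ∧
      (H * f).ker = (G * f).ker ∧ H.ker = G.ker := by
  obtain ⟨r, r', hr, hrr, hker⟩ := exists_isIdempotentElem_ker_eq hN G.isClosed_ker
  have hrfG : r * f * G = r := by
    rw [mul_assoc]
    exact mul_eq_of_ker_le hGf.isIdempotentElem_mul_left (by rw [hGf.ker_mul_left, hker])
  obtain ⟨S, S', hS, hTS⟩ := (hr.mul hf).exists_isOuterInverse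
    (show IsOuterInverse (r * f) G by rw [IsOuterInverse, hrfG, ← mul_assoc, hrr.eq])
  have hTSr : r * f * S * r = r := calc
    r * f * S * r = r * f * S * (r * f) * G := by rw [mul_assoc _ (r * f), hrfG]
    _ = r := by rw [hTS, hrfG]
  have hkerH : (S * r).ker = G.ker := by
    rw [← hker]
    refine le_antisymm (fun x (hx : S (r x) = 0) => ?_) (LinearMap.ker_le_ker_comp _ _)
    calc r x = r (f (S (r x))) := (DFunLike.congr_fun hTSr x).symm
      _ = 0 := by rw [hx, map_zero, map_zero]
  refine ⟨S * r, r' * S', hS.mul hr, ?_, congrArg (Submodule.comap f.toLinearMap) hkerH, hkerH⟩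
  calc S * r * f * (S * r) = S * (r * f * S * r) := by simp only [mul_assoc]
    _ = S * r := by rw [hTSr]

variable {F : AdjointableOp A E} {M₁ N₁ M₂ N₂ : Submodule A E}

theorem IsDiagonalDecomposition.exists_areAdjoint_isOuterInverse
    (h : IsDiagonalDecomposition F M₁ N₁ M₂ N₂) (hN : N₁.FG ∨ N₂.FG) :
    ∃ G G' : E →L[A] E, AreAdjoint G G' ∧ IsOuterInverse G F.toCLM ∧
      Nonempty (N₁ ≃L[A] (G * F.toCLM).ker) ∧ Nonempty (N₂ ≃L[A] G.ker) := by
  obtain ⟨G, hG, rfl, rfl⟩ := h.exists_isOuterInverse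
  rcases hN with hN | hN
  · exact hG.exists_areAdjoint_of_fg_ker_mul F.inner_left hN
  · obtain ⟨H, H', hHH', hH, hHF, hker⟩ := hG.exists_areAdjoint_of_fg_ker F.inner_left hN
    exact ⟨H, H', hHH', hH, ⟨.ofEq _ _ hHF.symm⟩, ⟨.ofEq _ _ hker.symm⟩⟩

theorem IsDiagonalDecomposition.exists_adjoint
    (h : IsDiagonalDecomposition F M₁ N₁ M₂ N₂) (hN : N₁.FG ∨ N₂.FG) :
    ∃ M₁' N₁' M₂' N₂' : Submodule A E, IsDiagonalDecomposition F.adjoint M₁' N₁' M₂' N₂' ∧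
      Nonempty (N₂ ≃L[A] N₁') ∧ Nonempty (N₁ ≃L[A] N₂') := by
  obtain ⟨G, G', hGG', hG, ⟨e₁⟩, ⟨e₂⟩⟩ := h.exists_areAdjoint_isOuterInverse hN
  have hF : AreAdjoint F.toCLM F.adjCLM := F.inner_left
  have hG' : IsOuterInverse G' F.adjoint.toCLM := hG.adjoint hF hGG'
  obtain ⟨u⟩ := (hF.mul hGG').nonempty_ker_equiv_ker hG.isIdempotentElem_mul_left
  obtain ⟨v⟩ := (hGG'.mul hF).nonempty_ker_equiv_ker hG.isIdempotentElem_mul_right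
  rw [hG.ker_mul_left] at u
  exact ⟨_, _, _, _, hG'.isDiagonalDecomposition, ⟨e₂.trans u⟩,
    ⟨e₁.trans (v.trans (.ofEq _ _ hG'.ker_mul_left))⟩⟩

end AdjointableOuterInverse

section Subequivalence

theorem exists_equiv_range_of_isEmbedding {R X Y : Type*} [Semiring R] [AddCommMonoid X]
    [TopologicalSpace X] [Module R X] [AddCommMonoid Y] [TopologicalSpace Y] [Module R Y]
    {j : X →L[R] Y} (hj : Topology.IsEmbedding j) : Nonempty (X ≃L[R] j.range) := by
  let e : X ≃ₗ[R] j.range := .ofInjective j.toLinearMap hj.injective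
  refine ⟨⟨e, hj.toHomeomorph.continuous, hj.continuous_iff.2 ?_⟩⟩
  exact continuous_subtype_val.congr fun y => (congrArg Subtype.val (e.apply_symm_apply y)).symm

theorem fg_of_equiv {R X Y : Type*} [Semiring R] [AddCommMonoid X] [Module R X] [AddCommMonoid Y]
    [Module R Y] {N : Submodule R X} {P : Submodule R Y} (h : N.FG) (e : N ≃ₗ[R] P) : P.FG := by
  rw [← Module.Finite.iff_fg] at h ⊢
  exact .equiv e

variable {A E : Type*} [CStarAlgebra A] [NormedAddCommGroup E] [Module A E]
  {N N' P P' : Submodule A E}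

theorem IsSubequivalent.congr (h : IsSubequivalent N P) (e : N ≃L[A] N') (f : P ≃L[A] P')
    (hP' : IsClosed (P' : Set E)) : IsSubequivalent N' P' := by
  obtain ⟨Q, hQP, hQ, ⟨g⟩⟩ := h
  let i : Q →L[A] P := Q.subtypeL.codRestrict P fun x => hQP x.2
  have hi : Topology.IsClosedEmbedding i := .of_comp .subtypeVal hQ.isClosedEmbedding_subtypeVal
  let j : Q →L[A] E := P'.subtypeL ∘L (f : P →L[A] P') ∘L i
  have hj : Topology.IsClosedEmbedding j :=
    hP'.isClosedEmbedding_subtypeVal.comp (f.toHomeomorph.isClosedEmbedding.comp hi)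
  obtain ⟨u⟩ := exists_equiv_range_of_isEmbedding hj.isEmbedding
  refine ⟨j.range, ?_, hj.isClosed_range, ⟨e.symm.trans (g.trans u)⟩⟩
  rintro _ ⟨x, rfl⟩
  exact (f (i x)).2

end Subequivalence

section Completeness

open Filter Topology

theorem norm_sum_add_mul_star_le {A ι : Type*} [CStarAlgebra A] (x y : ι → A) (s : Finset ι) :
    ‖∑ k ∈ s, (x k + y k) * star (x k + y k)‖ ≤
      2 * ‖∑ k ∈ s, x k * star (x k)‖ + 2 * ‖∑ k ∈ s, y k * star (y k)‖ := by
  let _ : PartialOrder A := CStarAlgebra.spectralOrder A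
  have _ : StarOrderedRing A := CStarAlgebra.spectralOrderedRing A
  have parallelogram (a b : A) : (a + b) * star (a + b) + (a - b) * star (a - b) =
      (2 : ℝ) • (a * star a) + (2 : ℝ) • (b * star b) := by
    simp only [star_add, star_sub, two_smul]
    noncomm_ring
  calc ‖∑ k ∈ s, (x k + y k) * star (x k + y k)‖
      ≤ ‖∑ k ∈ s, ((2 : ℝ) • (x k * star (x k)) + (2 : ℝ) • (y k * star (y k)))‖ :=
        CStarAlgebra.norm_le_norm_of_nonneg_of_le
          (Finset.sum_nonneg fun k _ => mul_star_self_nonneg _)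
          (Finset.sum_le_sum fun k _ =>
            parallelogram (x k) (y k) ▸ le_add_of_nonneg_right (mul_star_self_nonneg _))
    _ = ‖(2 : ℝ) • ∑ k ∈ s, x k * star (x k) + (2 : ℝ) • ∑ k ∈ s, y k * star (y k)‖ := by
        rw [Finset.sum_add_distrib, Finset.smul_sum, Finset.smul_sum]
    _ ≤ 2 * ‖∑ k ∈ s, x k * star (x k)‖ + 2 * ‖∑ k ∈ s, y k * star (y k)‖ := by
        refine (norm_add_le _ _).trans_eq ?_
        simp only [norm_smul, Real.norm_ofNat]

namespace StandardModule

variable {A : Type*} [CStarAlgebra A]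

theorem summable_mul_star_of_forall_exists {v : ℕ → A}
    (h : ∀ ε > 0, ∃ x : StandardModule A,
      ∀ s : Finset ℕ, ‖∑ k ∈ s, (v k - x k) * star (v k - x k)‖ ≤ ε) :
    Summable fun k => v k * star (v k) := by
  rw [summable_iff_vanishing_norm]
  intro ε hε
  obtain ⟨x, hx⟩ := h (ε / 8) (by positivity)
  obtain ⟨s, hs⟩ := summable_iff_vanishing_norm.1 (summable_inner x x) (ε / 8) (by positivity)
  refine ⟨s, fun t ht => ?_⟩
  have hadd := norm_sum_add_mul_star_le (fun k => v k - x k) x t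
  simp only [sub_add_cancel] at hadd
  linarith [hx t, hs t ht]

variable [PartialOrder A] [StarOrderedRing A]

theorem norm_sum_mul_star_le (x : StandardModule A) (s : Finset ℕ) :
    ‖∑ k ∈ s, x k * star (x k)‖ ≤ ‖x‖ ^ 2 := by
  rw [CStarModule.norm_sq_eq A]
  exact CStarAlgebra.norm_le_norm_of_nonneg_of_le (Finset.sum_nonneg fun k _ =>
    mul_star_self_nonneg _) ((summable_inner x x).sum_le_tsum s fun k _ => mul_star_self_nonneg _)

theorem norm_le_of_forall_norm_sum_le {x : StandardModule A} {C : ℝ} (hC : 0 ≤ C)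
    (h : ∀ s : Finset ℕ, ‖∑ k ∈ s, x k * star (x k)‖ ≤ C ^ 2) : ‖x‖ ≤ C := by
  rw [← pow_le_pow_iff_left₀ (norm_nonneg _) hC two_ne_zero, CStarModule.norm_sq_eq A]
  exact le_of_tendsto (summable_inner x x).hasSum.norm (.of_forall h)

theorem norm_apply_le (x : StandardModule A) (k : ℕ) : ‖x k‖ ≤ ‖x‖ := by
  have h := norm_sum_mul_star_le x {k}
  rw [Finset.sum_singleton, CStarRing.norm_self_mul_star, ← sq] at h
  exact (pow_le_pow_iff_left₀ (norm_nonneg _) (norm_nonneg _) two_ne_zero).1 h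

theorem norm_sum_sub_mul_star_le_of_tendsto {ι : Type*} {l : Filter ι} [l.NeBot]
    {u : ι → StandardModule A} {v : ℕ → A} (hv : ∀ k, Tendsto (fun n => u n k) l (𝓝 (v k)))
    {x : StandardModule A} {C : ℝ} (hC : ∀ᶠ n in l, ‖u n - x‖ ≤ C) (s : Finset ℕ) :
    ‖∑ k ∈ s, (v k - x k) * star (v k - x k)‖ ≤ C ^ 2 := by
  have hlim : Tendsto (fun n => ‖∑ k ∈ s, (u n k - x k) * star (u n k - x k)‖) l
      (𝓝 ‖∑ k ∈ s, (v k - x k) * star (v k - x k)‖) :=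
    (tendsto_finsetSum _ fun k _ =>
      ((hv k).sub_const _).mul ((hv k).sub_const _).star).norm
  refine le_of_tendsto hlim (hC.mono fun n hn => ?_)
  exact (norm_sum_mul_star_le (u n - x) s).trans (pow_le_pow_left₀ (norm_nonneg _) hn 2)

theorem exists_tendsto_apply_of_cauchySeq {u : ℕ → StandardModule A} (hu : CauchySeq u) (k : ℕ) :
    ∃ a : A, Tendsto (fun n => u n k) atTop (𝓝 a) := by
  have hlip : LipschitzWith 1 fun x : StandardModule A => x k := .of_dist_le_mul fun x y => by
    rw [NNReal.coe_one, one_mul, dist_eq_norm, dist_eq_norm]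
    exact norm_apply_le (x - y) k
  exact cauchySeq_tendsto_of_complete (hu.map hlip.uniformContinuous)

instance : CompleteSpace (StandardModule A) := by
  refine Metric.complete_of_cauchySeq_tendsto fun u hu => ?_
  choose v hv using exists_tendsto_apply_of_cauchySeq hu
  have hclose : ∀ ε > 0, ∃ N, ∀ n ≥ N, ∀ s : Finset ℕ,
      ‖∑ k ∈ s, (v k - u n k) * star (v k - u n k)‖ ≤ ε ^ 2 := by
    intro ε hε
    obtain ⟨N, hN⟩ := Metric.cauchySeq_iff.1 hu ε hε
    refine ⟨N, fun n hn => norm_sum_sub_mul_star_le_of_tendsto hv ?_⟩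
    filter_upwards [eventually_ge_atTop N] with m hm
    exact dist_eq_norm (u m) (u n) ▸ (hN m hm n hn).le
  have hsum : Summable fun k => v k * star (v k) := by
    refine summable_mul_star_of_forall_exists fun ε hε => ?_
    obtain ⟨N, hN⟩ := hclose √ε (Real.sqrt_pos.2 hε)
    exact ⟨u N, Real.sq_sqrt hε.le ▸ hN N le_rfl⟩
  let w : StandardModule A := ⟨v, hsum⟩
  refine ⟨w, Metric.tendsto_atTop.2 fun ε hε => ?_⟩
  obtain ⟨N, hN⟩ := hclose (ε / 2) (half_pos hε)
  refine ⟨N, fun n hn => ?_⟩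
  calc dist (u n) w = ‖w - u n‖ := by rw [dist_comm, dist_eq_norm]
    _ ≤ ε / 2 := norm_le_of_forall_norm_sum_le (half_pos hε).le (hN n hn)
    _ < ε := half_lt_self hε

end StandardModule

end Completeness

section Classes

variable {A E : Type*} [CStarAlgebra A] [PartialOrder A] [StarOrderedRing A]
  [NormedAddCommGroup E] [NormedSpace ℂ E] [Module A E] [CStarModule A E] [CompleteSpace E]
  {F : AdjointableOp A E}

theorem adjoint_mem_MPhiMinus_iff : F.adjoint ∈ MPhiMinus A E ↔ F ∈ MPhiPlus A E := by
  constructor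
  · rintro ⟨M₁, N₁, M₂, N₂, h, h₂⟩
    obtain ⟨M₁', N₁', M₂', N₂', h', ⟨e₁⟩, -⟩ := h.exists_adjoint (.inr h₂)
    exact ⟨M₁', N₁', M₂', N₂', h', fg_of_equiv h₂ e₁.toLinearEquiv⟩
  · rintro ⟨M₁, N₁, M₂, N₂, h, h₁⟩
    obtain ⟨M₁', N₁', M₂', N₂', h', -, ⟨e₂⟩⟩ := h.exists_adjoint (.inl h₁)
    exact ⟨M₁', N₁', M₂', N₂', h', fg_of_equiv h₁ e₂.toLinearEquiv⟩

theorem adjoint_mem_MPhi (hF : F ∈ MPhi A E) : F.adjoint ∈ MPhi A E := by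
  obtain ⟨M₁, N₁, M₂, N₂, h, h₁, h₂⟩ := hF
  obtain ⟨M₁', N₁', M₂', N₂', h', ⟨e₁⟩, ⟨e₂⟩⟩ := h.exists_adjoint (.inl h₁)
  exact ⟨M₁', N₁', M₂', N₂', h', fg_of_equiv h₂ e₁.toLinearEquiv, fg_of_equiv h₁ e₂.toLinearEquiv⟩

theorem adjoint_mem_MPhi_iff : F.adjoint ∈ MPhi A E ↔ F ∈ MPhi A E :=
  ⟨adjoint_mem_MPhi, adjoint_mem_MPhi⟩

theorem adjoint_mem_MPhiMinusPlusPrime_iff :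
    F.adjoint ∈ MPhiMinusPlusPrime A E ↔ F ∈ MPhiPlusMinusPrime A E := by
  refine and_congr adjoint_mem_MPhiMinus_iff ⟨?_, ?_⟩
  · rintro ⟨M₁, N₁, M₂, N₂, h, h₂, hle⟩
    obtain ⟨M₁', N₁', M₂', N₂', h', ⟨e₁⟩, ⟨e₂⟩⟩ := h.exists_adjoint (.inr h₂)
    exact ⟨M₁', N₁', M₂', N₂', h', fg_of_equiv h₂ e₁.toLinearEquiv, hle.congr e₁ e₂ h'.isClosed_N₂⟩
  · rintro ⟨M₁, N₁, M₂, N₂, h, h₁, hle⟩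
    obtain ⟨M₁', N₁', M₂', N₂', h', ⟨e₁⟩, ⟨e₂⟩⟩ := h.exists_adjoint (.inl h₁)
    exact ⟨M₁', N₁', M₂', N₂', h', fg_of_equiv h₁ e₂.toLinearEquiv, hle.congr e₂ e₁ h'.isClosed_N₁⟩

theorem adjoint_mem_MPhiMinusPlusTilde_iff :
    F.adjoint ∈ MPhiMinusPlusTilde A E ↔ F ∈ MPhiPlusMinusTilde A E := by
  refine and_congr adjoint_mem_MPhi_iff ⟨?_, ?_⟩
  · rintro ⟨M₁, N₁, M₂, N₂, h, h₁, h₂, hle⟩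
    obtain ⟨M₁', N₁', M₂', N₂', h', ⟨e₁⟩, ⟨e₂⟩⟩ := h.exists_adjoint (.inr h₂)
    exact ⟨M₁', N₁', M₂', N₂', h', fg_of_equiv h₂ e₁.toLinearEquiv, fg_of_equiv h₁ e₂.toLinearEquiv,
      hle.congr e₁ e₂ h'.isClosed_N₂⟩
  · rintro ⟨M₁, N₁, M₂, N₂, h, h₁, h₂, hle⟩
    obtain ⟨M₁', N₁', M₂', N₂', h', ⟨e₁⟩, ⟨e₂⟩⟩ := h.exists_adjoint (.inl h₁)
    exact ⟨M₁', N₁', M₂', N₂', h', fg_of_equiv h₂ e₁.toLinearEquiv, fg_of_equiv h₁ e₂.toLinearEquiv,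
      hle.congr e₂ e₁ h'.isClosed_N₁⟩

theorem adjoint_mem_MPhiMinusPlus_iff :
    F.adjoint ∈ MPhiMinusPlus A E ↔ F ∈ MPhiPlusMinus A E :=
  or_congr adjoint_mem_MPhiMinusPlusTilde_iff
    (and_congr adjoint_mem_MPhiMinus_iff (not_congr adjoint_mem_MPhi_iff))

variable (F) in
theorem proposition5p11_general :
    (F ∈ MPhiPlusMinusPrime A E ↔ F.adjoint ∈ MPhiMinusPlusPrime A E) ∧
    (F ∈ MPhiPlusMinusTilde A E ↔ F.adjoint ∈ MPhiMinusPlusTilde A E) ∧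
    (F ∈ MPhiPlusMinus A E ↔ F.adjoint ∈ MPhiMinusPlus A E) :=
  ⟨adjoint_mem_MPhiMinusPlusPrime_iff.symm, adjoint_mem_MPhiMinusPlusTilde_iff.symm,
    adjoint_mem_MPhiMinusPlus_iff.symm⟩

end Classes

theorem proposition5p11 {A : Type*} [CStarAlgebra A] [PartialOrder A] [StarOrderedRing A]
    (F : AdjointableOp A (StandardModule A)) :
    (F ∈ MPhiPlusMinusPrime A (StandardModule A) ↔
      F.adjoint ∈ MPhiMinusPlusPrime A (StandardModule A)) ∧
    (F ∈ MPhiPlusMinusTilde A (StandardModule A) ↔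
      F.adjoint ∈ MPhiMinusPlusTilde A (StandardModule A)) ∧
    (F ∈ MPhiPlusMinus A (StandardModule A) ↔
      F.adjoint ∈ MPhiMinusPlus A (StandardModule A)) :=
  proposition5p11_general F
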